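/- All hypergraphs are finite, directed and edge-coloured: an edge is an ordered tuple $(v_1,\dots,v_r;c)$ of $r\ge 2$ distinct vertices together with a colour $c$ from a fixed colour set, and the edges of a hypergraph form a finite set. For $U\subseteq V(G)$, $G[U]$ is the subhypergraph with vertex set $U$ whose edges are the edges of $G$ all of whose vertices lie in $U$. Let $\mathcal P$ be an additive induced-hereditary property, that is, a nonempty isomorphism-closed class of such hypergraphs that is closed under induced subhypergraphs and under disjoint unions. For hypergraphs $G_1,\dots,G_n$ on disjoint vertex sets, $G_1*\cdots*G_n$ denotes the set of all hypergraphs $H$ with $V(H)=\bigcup_i V(G_i)$ and $H[V(G_i)]=G_i$ for all $i$; $kG$ is the disjoint union of $k$ copies of $G$, and $K_1$ is the one-vertex hypergraph. A *$\mathcal P$-decomposition of $G$ with $n$ parts* is a partition $(V_1,\dots,V_n)$ of $V(G)$ into nonempty sets such that $kG[V_1]*\cdots*kG[V_n]\subseteq\mathcal P$ for every positive integer $k$; $\mathrm{dec}_{\mathcal P}(G)$ is the maximum number of parts in a $\mathcal P$-decomposition of $G$ (and $0$ if $G\notin\mathcal P$). $G$ is *$\mathcal P$-strict* if $G\in\mathcal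 P$ but $G*K_1\not\subseteq\mathcal P$, and $\mathrm{dec}(\mathcal P)$ is the minimum of $\mathrm{dec}_{\mathcal P}(G)$ over all $\mathcal P$-strict hypergraphs $G$. **Statement.** Let $G$ be a $\mathcal P$-strict hypergraph with $\mathrm{dec}_{\mathcal P}(G)=\mathrm{dec}(\mathcal P)$, and let $d_0=(U_1,\dots,U_m)$ be any $\mathcal P$-decomposition of $G$. Then $G$ has a $\mathcal P$-decomposition $(V_1,\dots,V_n)$ with exactly $n=\mathrm{dec}(\mathcal P)$ parts that respects $d_0$, i.e. each $V_i$ is contained in some $U_j$. -/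

import Mathlib

universe u v w x

/-- A directed, coloured hyperedge `(v₁, …, v_r; c)` on the vertex set `V`
with colour `c` in the colour set `C`. -/
abbrev DirEdge (V : Type u) (C : Type x) : Type (max u x) := List V × C

/-- The image `(f v₁, …, f v_r; c)` of an edge under a map of vertices; direction and
colour are kept. -/
def DirEdge.map {V : Type u} {W : Type v} {C : Type x} (f : V → W) (e : DirEdge V C) :
    DirEdge W C :=
  (e.1.map f, e.2)

theorem DirEdge.map_injective {V : Type u} {W : Type v} {C : Type x} {f : V → W}
    (hf : Function.Injective f) :
    Function.Injective (DirEdge.map f : DirEdge V C → DirEdge W C) := by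
  rintro ⟨l, c⟩ ⟨l', c'⟩ h
  simp only [DirEdge.map, Prod.mk.injEq] at h
  exact Prod.ext (List.map_injective_iff.2 hf h.1) h.2

/-- A directed coloured hypergraph on the vertex set `V` with edge colours in `C`:
a finite set of edges, each edge an ordered tuple of at least two distinct vertices together
with a colour.  The vertex set is required to be finite wherever hypergraphs are used. -/
@[ext]
structure DirHypergraph (V : Type u) (C : Type x) where
  /-- the edge set -/
  edges : Set (DirEdge V C)
  finite_edges : edges.Finite
  nodup : ∀ e ∈ edges, e.1.Nodup
  no_loops : ∀ e ∈ edges, 2 ≤ e.1.length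

namespace DirHypergraph

variable {V : Type u} {W : Type v} {C : Type x}

/-- The hypergraph on `W` whose edges are the edges of `G` lying inside the image of the
embedding `f : W ↪ V`, pulled back along `f`. -/
def comap (f : W ↪ V) (G : DirHypergraph V C) : DirHypergraph W C where
  edges := DirEdge.map f ⁻¹' G.edges
  finite_edges := G.finite_edges.preimage (DirEdge.map_injective f.injective).injOn
  nodup := fun e he => List.Nodup.of_map f (G.nodup _ he)
  no_loops := fun e he => by simpa [DirEdge.map] using G.no_loops _ he

/-- The subhypergraph `G[U]` induced by a set `U` of vertices. -/
def induce (G : DirHypergraph V C) (U : Set V) : DirHypergraph U C :=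
  G.comap (Function.Embedding.subtype (· ∈ U))

/-- `G` and `H` are isomorphic: some bijection of the vertex sets preserves and reflects
edges, with their directions and colours. -/
def IsIso (G : DirHypergraph V C) (H : DirHypergraph W C) : Prop :=
  ∃ f : V ≃ W, ∀ e : DirEdge V C, e ∈ G.edges ↔ DirEdge.map f e ∈ H.edges

/-- `H ≤ G`: `H` is isomorphic to `G[U]` for some set `U` of vertices of `G`. -/
def IsInducedSub (H : DirHypergraph W C) (G : DirHypergraph V C) : Prop :=
  ∃ U : Set V, IsIso H (G.induce U)

/-- The disjoint union of two hypergraphs. -/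
def disjUnion (G : DirHypergraph V C) (H : DirHypergraph W C) : DirHypergraph (V ⊕ W) C where
  edges := DirEdge.map Sum.inl '' G.edges ∪ DirEdge.map Sum.inr '' H.edges
  finite_edges := (G.finite_edges.image _).union (H.finite_edges.image _)
  nodup := by
    rintro _ (⟨e, he, rfl⟩ | ⟨e, he, rfl⟩)
    · exact (G.nodup e he).map Sum.inl_injective
    · exact (H.nodup e he).map Sum.inr_injective
  no_loops := by
    rintro _ (⟨e, he, rfl⟩ | ⟨e, he, rfl⟩)
    · simpa [DirEdge.map] using G.no_loops e he
    · simpa [DirEdge.map] using H.no_loops e he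

/-- `k G`, the disjoint union of `k` copies of `G`. -/
def copies (k : ℕ) (G : DirHypergraph V C) : DirHypergraph (Fin k × V) C where
  edges := ⋃ i : Fin k, DirEdge.map (Prod.mk i) '' G.edges
  finite_edges := Set.finite_iUnion fun _ => G.finite_edges.image _
  nodup := by
    intro e' he'
    obtain ⟨i, e, he, rfl⟩ := Set.mem_iUnion.1 he'
    exact (G.nodup e he).map (Prod.mk_right_injective i)
  no_loops := by
    intro e' he'
    obtain ⟨i, e, he, rfl⟩ := Set.mem_iUnion.1 he'
    simpa [DirEdge.map] using G.no_loops e he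

/-- The hypergraph `K₁` with one vertex and no edge. -/
def kOne (C : Type x) : DirHypergraph Unit C where
  edges := ∅
  finite_edges := Set.finite_empty
  nodup := fun _ he => he.elim
  no_loops := fun _ he => he.elim

/-- The `*`-join `G * H` of two hypergraphs: all hypergraphs on the disjoint union of the
vertex sets that induce `G` on `V` and `H` on `W`. -/
def starJoin₂ (G : DirHypergraph V C) (H : DirHypergraph W C) :
    Set (DirHypergraph (V ⊕ W) C) :=
  {K | K.comap Function.Embedding.inl = G ∧ K.comap Function.Embedding.inr = H}

/-- The `*`-join `G₁ * ⋯ * G_n` of a family of hypergraphs: all hypergraphs on the disjoint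
union of the vertex sets that induce `G i` on the `i`-th vertex set, for every `i`. -/
def starJoin {ι : Type w} {V : ι → Type u} (G : ∀ i, DirHypergraph (V i) C) :
    Set (DirHypergraph (Σ i, V i) C) :=
  {K | ∀ i, K.comap (Function.Embedding.sigmaMk i) = G i}

end DirHypergraph

/-- A property of finite hypergraphs with edge colours in `C`: a nonempty
isomorphism-closed class of finite hypergraphs. -/
structure HypergraphProperty (C : Type x) where
  /-- `Holds G` means that `G` belongs to the class -/
  Holds : ∀ {V : Type} [Finite V], DirHypergraph V C → Prop
  exists_holds : ∃ (V : Type) (_ : Finite V) (G : DirHypergraph V C), Holds G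
  iso_closed : ∀ {V W : Type} [Finite V] [Finite W] (G : DirHypergraph V C)
    (H : DirHypergraph W C), G.IsIso H → Holds G → Holds H

namespace HypergraphProperty

variable {C : Type x} (P : HypergraphProperty C)

/-- `P` is induced-hereditary: closed under induced subhypergraphs. -/
def InducedHereditary : Prop :=
  ∀ {V W : Type} [Finite V] [Finite W] (G : DirHypergraph V C) (H : DirHypergraph W C),
    P.Holds G → H.IsInducedSub G → P.Holds H

/-- `P` is additive: closed under disjoint unions. -/
def Additive : Prop :=
  ∀ {V W : Type} [Finite V] [Finite W] (G : DirHypergraph V C) (H : DirHypergraph W C),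
    P.Holds G → P.Holds H → P.Holds (G.disjUnion H)

/-- `(d 0, …, d (n - 1))` is a `P`-decomposition of `G` with `n` parts: a partition of the
vertex set into nonempty parts such that `k G[d 0] * ⋯ * k G[d (n - 1)] ⊆ P` for all
positive integers `k`. -/
structure IsDecomposition {V : Type} [Finite V] (G : DirHypergraph V C) {n : ℕ}
    (d : Fin n → Set V) : Prop where
  nonempty : ∀ i, (d i).Nonempty
  disjoint : ∀ i j, i ≠ j → Disjoint (d i) (d j)
  cover : ⋃ i, d i = Set.univ
  join_subset : ∀ k : ℕ, 0 < k →
    ∀ H ∈ DirHypergraph.starJoin (fun i => (G.induce (d i)).copies k), P.Holds H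

open Classical in
/-- The decomposability number `dec_P(G)`: the maximum number of parts in a
`P`-decomposition of `G` (at most the number of vertices), and `0` if `G` is not in `P`. -/
noncomputable def decOf {V : Type} [Finite V] (G : DirHypergraph V C) : ℕ :=
  if P.Holds G then sSup {n : ℕ | ∃ d : Fin n → Set V, P.IsDecomposition G d} else 0

/-- `G` is `P`-strict: `G` is in `P`, but `G * K₁` is not contained in `P`. -/
def IsStrict {V : Type} [Finite V] (G : DirHypergraph V C) : Prop :=
  P.Holds G ∧ ¬ ∀ H ∈ G.starJoin₂ (DirHypergraph.kOne C), P.Holds H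

/-- The decomposability number `dec(P)`: the minimum of `dec_P(G)` over all `P`-strict
hypergraphs `G`. -/
noncomputable def dec : ℕ :=
  sInf {n : ℕ | ∃ (V : Type) (_ : Finite V) (G : DirHypergraph V C),
    P.IsStrict G ∧ P.decOf G = n}

end HypergraphProperty

/-- The partition `d` respects the partition `d₀`: each part of `d` is contained in some
part of `d₀`. -/
def PartsRespect {V : Type u} {n m : ℕ} (d : Fin n → Set V) (d₀ : Fin m → Set V) : Prop :=
  ∀ i, ∃ j, d i ⊆ d₀ j

/-! Partitions are treated as colourings, and a colouring is free if it satisfies the `join_subset`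
condition. Let `u` be the colouring of `d₀` and `n = dec(P)`. A bad colouring is a surjective `t : V
→ Fin n` that does not refine `u`. Then `(t, u)` takes more than `n = dec_P(G)` values, so it is not
free (`not_isFree_prod`): some `F ∉ P` agrees with some `kG` inside the classes of `(t, u)`.

These witnesses `F` are used to build an amalgam `H` of copies of `G` such that no decomposition of
`H` is bad on every copy (`exists_isAmalgam_avoiding`). All added edges cross classes of `u`, so
freeness of `u` gives `H ∈ P`. Since `H` contains `G`, it is strict, hence has a decomposition with
at least `n` parts. Every part meets every copy of `G` by strictness (`IsStrict.exists_colour_eq`),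
so each copy inherits a decomposition with equally many parts, and their number is exactly `n`. On a
copy where it is not bad, it refines `u`. -/

theorem DirEdge.map_comp {V : Type u} {W : Type v} {X : Type w} {C : Type x}
    (g : W → X) (f : V → W) (e : DirEdge V C) :
    DirEdge.map g (DirEdge.map f e) = DirEdge.map (g ∘ f) e := by
  simp [DirEdge.map]

theorem DirEdge.map_id' {V : Type u} {C : Type x} (e : DirEdge V C) :
    DirEdge.map (fun v => v) e = e := by
  simp [DirEdge.map]

theorem DirEdge.mem_map {V : Type u} {W : Type v} {C : Type x} (f : V → W)
    (e : DirEdge V C) (y : W) : y ∈ (DirEdge.map f e).1 ↔ ∃ v ∈ e.1, f v = y := by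
  simp [DirEdge.map]

theorem DirEdge.exists_map_eq {V : Type u} {W : Type v} {C : Type x} (f : V → W)
    (e : DirEdge W C) (h : ∀ y ∈ e.1, ∃ v, f v = y) : ∃ e', DirEdge.map f e' = e := by
  have : e.1 ∈ Set.range (List.map f) := by
    rw [Set.range_list_map]
    exact fun y hy => h y hy
  obtain ⟨l, hl⟩ := this
  exact ⟨(l, e.2), Prod.ext hl rfl⟩

theorem DirEdge.map_congr {V : Type u} {W : Type v} {C : Type x} {f g : V → W}
    {e : DirEdge V C} (h : ∀ x ∈ e.1, f x = g x) : DirEdge.map f e = DirEdge.map g e :=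
  Prod.ext (List.map_congr_left h) rfl

/-! ### Copies, agreement inside colour classes, and patching. -/

namespace DirHypergraph

variable {V : Type u} {W : Type v} {X : Type w} {C : Type x}

theorem mem_comap (f : W ↪ V) (G : DirHypergraph V C) (e : DirEdge W C) :
    e ∈ (G.comap f).edges ↔ DirEdge.map f e ∈ G.edges := Iff.rfl

theorem comap_comap (f : W ↪ V) (g : X ↪ W) (G : DirHypergraph V C) :
    (G.comap f).comap g = G.comap (g.trans f) := by
  ext e
  simp only [mem_comap, DirEdge.map_comp]
  rfl

theorem exists_mem {G : DirHypergraph V C} {e : DirEdge V C} (he : e ∈ G.edges) :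
    ∃ x, x ∈ e.1 :=
  List.exists_mem_of_length_pos (by have := G.no_loops e he; omega)

theorem isInducedSub_comap (f : W ↪ V) (G : DirHypergraph V C) :
    (G.comap f).IsInducedSub G := by
  refine ⟨Set.range f, Equiv.ofInjective f f.injective, fun e => ?_⟩
  simp only [induce, mem_comap, DirEdge.map_comp]
  rfl

theorem isIso_comap (f : W ≃ V) (G : DirHypergraph V C) :
    (G.comap f.toEmbedding).IsIso G :=
  ⟨f, fun _ => Iff.rfl⟩

theorem mem_copies (k : ℕ) (G : DirHypergraph V C) (e : DirEdge (Fin k × V) C) :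
    e ∈ (G.copies k).edges ↔ ∃ p, (∀ x ∈ e.1, x.1 = p) ∧ DirEdge.map Prod.snd e ∈ G.edges := by
  simp only [copies, Set.mem_iUnion, Set.mem_image]
  refine exists_congr fun p => ⟨?_, ?_⟩
  · rintro ⟨e, he, rfl⟩
    refine ⟨fun x hx => ?_, ?_⟩
    · obtain ⟨v, -, rfl⟩ := (DirEdge.mem_map _ _ _).1 hx
      rfl
    · rw [DirEdge.map_comp]
      simpa [Function.comp_def, DirEdge.map_id'] using he
  · rintro ⟨h, he⟩
    refine ⟨_, he, ?_⟩
    rw [DirEdge.map_comp, DirEdge.map_congr (g := fun x => x), DirEdge.map_id']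
    intro x hx
    exact Prod.ext (h x hx).symm rfl

/-- `f` applied in each of the `k` copies. -/
def copiesEmb (k : ℕ) (f : W ↪ V) : Fin k × W ↪ Fin k × V :=
  (Function.Embedding.refl _).prodMap f

theorem copies_comap (k : ℕ) (f : W ↪ V) (G : DirHypergraph V C) :
    (G.copies k).comap (copiesEmb k f) = (G.comap f).copies k := by
  ext e
  simp only [mem_comap, mem_copies, DirEdge.map_comp]
  refine exists_congr fun p => and_congr ⟨fun h x hx => ?_, fun h y hy => ?_⟩ Iff.rfl
  · exact h _ ((DirEdge.mem_map _ _ _).2 ⟨x, hx, rfl⟩)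
  · obtain ⟨x, hx, rfl⟩ := (DirEdge.mem_map _ _ _).1 hy
    exact h x hx

/-- Two hypergraphs have the same edges inside each colour class of `χ`. -/
def Agree {ι : Type*} (χ : V → ι) (H K : DirHypergraph V C) : Prop :=
  ∀ e : DirEdge V C, (∃ c, ∀ y ∈ e.1, χ y = c) → (e ∈ H.edges ↔ e ∈ K.edges)

theorem Agree.of_injective {ι κ : Type*} {g : ι → κ} (hg : Function.Injective g) {χ : V → ι}
    {H K : DirHypergraph V C} (h : Agree χ H K) : Agree (g ∘ χ) H K := by
  rintro e ⟨c, hc⟩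
  -- On an empty tuple `c` may lie outside the range of `g`; but empty tuples are never edges.
  rcases hl : e.1 with _ | ⟨a, l⟩
  · constructor <;> intro he <;> obtain ⟨y, hy⟩ := exists_mem he <;> simp [hl] at hy
  · exact h e ⟨χ a, fun y hy => hg ((hc y hy).trans (hc a (by simp [hl])).symm)⟩

/-- The hypergraph `H` with the part on the range of `f` replaced by `K`. -/
def patch (f : W ↪ V) (K : DirHypergraph W C) (H : DirHypergraph V C) : DirHypergraph V C where
  edges := DirEdge.map f '' K.edges ∪ {e ∈ H.edges | e ∉ Set.range (DirEdge.map f)}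
  finite_edges := (K.finite_edges.image _).union (H.finite_edges.subset fun _ h => h.1)
  nodup := by
    rintro _ (⟨e, he, rfl⟩ | ⟨he, -⟩)
    · exact (K.nodup e he).map f.injective
    · exact H.nodup _ he
  no_loops := by
    rintro _ (⟨e, he, rfl⟩ | ⟨he, -⟩)
    · simpa [DirEdge.map] using K.no_loops e he
    · exact H.no_loops _ he

theorem map_mem_patch (f : W ↪ V) (K : DirHypergraph W C) (H : DirHypergraph V C)
    (e : DirEdge W C) : DirEdge.map f e ∈ (patch f K H).edges ↔ e ∈ K.edges := by
  constructor
  · rintro (⟨e', he, h⟩ | ⟨-, h⟩)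
    · rwa [← DirEdge.map_injective f.injective h]
    · exact (h ⟨e, rfl⟩).elim
  · exact fun h => Or.inl ⟨e, h, rfl⟩

theorem comap_patch (f : W ↪ V) (K : DirHypergraph W C) (H : DirHypergraph V C) :
    (patch f K H).comap f = K := by
  ext e
  exact map_mem_patch f K H e

/-- An admissible change of an induced subhypergraph extends to an admissible change of the whole.
This is why `AllAgree` passes to induced subhypergraphs. -/
theorem agree_patch {ι : Type*} {χ : V → ι} {f : W ↪ V} {K : DirHypergraph W C}
    {H : DirHypergraph V C} (h : Agree (χ ∘ f) (H.comap f) K) : Agree χ H (patch f K H) := by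
  rintro e ⟨c, hc⟩
  by_cases he : e ∈ Set.range (DirEdge.map f)
  · obtain ⟨e, rfl⟩ := he
    rw [map_mem_patch]
    exact h e ⟨c, fun y hy => hc _ ((DirEdge.mem_map _ _ _).2 ⟨y, hy, rfl⟩)⟩
  · constructor
    · exact fun h => Or.inr ⟨h, he⟩
    · rintro (⟨e', -, h⟩ | ⟨h, -⟩)
      · exact (he ⟨e', h⟩).elim
      · exact h

theorem exists_map_inl_or_inr {e : DirEdge (V ⊕ W) C} {c : Bool}
    (h : ∀ y ∈ e.1, y.isLeft = c) :
    (∃ e' : DirEdge V C, DirEdge.map Sum.inl e' = e) ∨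
      ∃ e' : DirEdge W C, DirEdge.map Sum.inr e' = e := by
  cases c
  · refine Or.inr (DirEdge.exists_map_eq _ _ fun y hy => ?_)
    rcases y with v | w
    · simpa using h _ hy
    · exact ⟨w, rfl⟩
  · refine Or.inl (DirEdge.exists_map_eq _ _ fun y hy => ?_)
    rcases y with v | w
    · exact ⟨v, rfl⟩
    · simpa using h _ hy

theorem map_inl_mem_disjUnion (G : DirHypergraph V C) (H : DirHypergraph W C)
    (e : DirEdge V C) : DirEdge.map Sum.inl e ∈ (G.disjUnion H).edges ↔ e ∈ G.edges := by
  constructor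
  · intro hm
    obtain ⟨y, hy⟩ := exists_mem hm
    rcases hm with ⟨e', he, h⟩ | ⟨e', he, h⟩
    · rwa [← DirEdge.map_injective Sum.inl_injective h]
    · obtain ⟨v, -, rfl⟩ := (DirEdge.mem_map _ _ _).1 hy
      rw [← h] at hy
      simp [DirEdge.mem_map] at hy
  · exact fun h => Or.inl ⟨e, h, rfl⟩

theorem map_inr_mem_disjUnion (G : DirHypergraph V C) (H : DirHypergraph W C)
    (e : DirEdge W C) : DirEdge.map Sum.inr e ∈ (G.disjUnion H).edges ↔ e ∈ H.edges := by
  constructor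
  · intro hm
    obtain ⟨y, hy⟩ := exists_mem hm
    rcases hm with ⟨e', he, h⟩ | ⟨e', he, h⟩
    · obtain ⟨v, -, rfl⟩ := (DirEdge.mem_map _ _ _).1 hy
      rw [← h] at hy
      simp [DirEdge.mem_map] at hy
    · rwa [← DirEdge.map_injective Sum.inr_injective h]
  · exact fun h => Or.inr ⟨e, h, rfl⟩

end DirHypergraph

namespace HypergraphProperty

open DirHypergraph

variable {C : Type x} (P : HypergraphProperty C)

/-! ### Free colourings and their dictionary with decompositions. -/

variable {P} in
theorem InducedHereditary.comap (hher : P.InducedHereditary) {V W : Type} [Finite V] [Finite W]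
    {G : DirHypergraph V C} (hG : P.Holds G) (f : W ↪ V) : P.Holds (G.comap f) :=
  hher _ _ hG (isInducedSub_comap f G)

/-- Every hypergraph that agrees with `H` on the colour classes of `χ` is in `P`. -/
def AllAgree {V : Type} [Finite V] {ι : Type*} (H : DirHypergraph V C) (χ : V → ι) : Prop :=
  ∀ K, Agree χ H K → P.Holds K

variable {P} in
theorem AllAgree.comap (hher : P.InducedHereditary) {V W : Type} [Finite V] [Finite W]
    {ι : Type*} {H : DirHypergraph V C} {χ : V → ι} (h : P.AllAgree H χ) (f : W ↪ V) :
    P.AllAgree (H.comap f) (χ ∘ f) := by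
  intro K hK
  have := hher.comap (h _ (agree_patch hK)) f
  rwa [comap_patch] at this

/-- The colour classes of `χ` satisfy the defining condition of a `P`-decomposition of `G`. -/
def IsFree {V : Type} [Finite V] {ι : Type*} (G : DirHypergraph V C) (χ : V → ι) : Prop :=
  ∀ k : ℕ, 0 < k → P.AllAgree (G.copies k) (χ ∘ Prod.snd)

variable {P} in
theorem IsFree.comap (hher : P.InducedHereditary) {V W : Type} [Finite V] [Finite W]
    {ι : Type*} {H : DirHypergraph V C} {χ : V → ι} (h : P.IsFree H χ) (f : W ↪ V) :
    P.IsFree (H.comap f) (χ ∘ f) := by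
  intro k hk
  rw [← copies_comap]
  exact (h k hk).comap hher (copiesEmb k f)

variable {P} in
theorem IsFree.of_injective {V : Type} [Finite V] {ι κ : Type*} {G : DirHypergraph V C}
    {χ : V → ι} {g : ι → κ} (hg : Function.Injective g) (h : P.IsFree G (g ∘ χ)) :
    P.IsFree G χ :=
  fun k hk K hK => h k hk K (hK.of_injective hg)

variable {P} in
theorem IsFree.allAgree (hher : P.InducedHereditary) {V : Type} [Finite V] {ι : Type*}
    {G : DirHypergraph V C} {χ : V → ι} (h : P.IsFree G χ) : P.AllAgree G χ := by
  have := (h 1 one_pos).comap hher ⟨Prod.mk 0, Prod.mk_right_injective 0⟩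
  change P.AllAgree _ χ at this
  convert this using 1
  ext e
  rw [mem_comap, mem_copies, DirEdge.map_comp]
  simp [DirEdge.mem_map, Function.comp_def, DirEdge.map_id']

/-- The vertices of `k G`, sorted by the fibres of `χ`. -/
def fibreEquiv {V : Type} {ι : Type} (χ : V → ι) (k : ℕ) :
    (Σ i, Fin k × (χ ⁻¹' {i} : Set V)) ≃ Fin k × V where
  toFun s := (s.2.1, s.2.2.1)
  invFun y := ⟨χ y.2, y.1, y.2, rfl⟩
  left_inv := by rintro ⟨_, p, v, rfl⟩; rfl
  right_inv _ := rfl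

theorem comap_fibreEquiv_mem_starJoin {V : Type} {ι : Type} (G : DirHypergraph V C)
    (χ : V → ι) (k : ℕ) (K : DirHypergraph (Fin k × V) C) :
    K.comap (fibreEquiv χ k).toEmbedding ∈
        starJoin (fun i => (G.induce (χ ⁻¹' {i})).copies k) ↔
      Agree (χ ∘ Prod.snd) (G.copies k) K := by
  simp only [starJoin, Set.mem_ofPred_eq, induce, ← copies_comap, comap_comap]
  constructor
  · rintro h e ⟨i, hi⟩
    obtain ⟨e, rfl⟩ := DirEdge.exists_map_eq
      (copiesEmb k (Function.Embedding.subtype (· ∈ χ ⁻¹' {i}))) e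
      (fun y hy => ⟨(y.1, ⟨y.2, hi y hy⟩), rfl⟩)
    exact (Set.ext_iff.1 (congrArg edges (h i)) e).symm
  · intro h i
    ext e
    refine (h _ ⟨i, fun y hy => ?_⟩).symm
    obtain ⟨v, -, rfl⟩ := (DirEdge.mem_map _ _ _).1 hy
    exact v.2.2

/-- With colourings, restriction to a subhypergraph is composition and common refinement is pairing;
surjectivity encodes nonempty parts. -/
theorem isDecomposition_fibres_iff {V : Type} [Finite V] (G : DirHypergraph V C) {n : ℕ}
    (χ : V → Fin n) :
    P.IsDecomposition G (fun i => χ ⁻¹' {i}) ↔ Function.Surjective χ ∧ P.IsFree G χ := by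
  constructor
  · intro h
    refine ⟨fun i => h.nonempty i, fun k hk K hK => ?_⟩
    have := h.join_subset k hk _ ((comap_fibreEquiv_mem_starJoin G χ k K).2 hK)
    exact P.iso_closed _ _ (isIso_comap _ _) this
  · rintro ⟨hs, hf⟩
    refine ⟨fun i => hs i, fun i j hij => ?_, ?_, fun k hk H hH => ?_⟩
    · rw [Set.disjoint_left]
      rintro v rfl h
      exact hij h
    · ext v
      simp
    · have e : (H.comap (fibreEquiv χ k).symm.toEmbedding).comap
          (fibreEquiv χ k).toEmbedding = H := by
        ext e
        simp only [mem_comap, DirEdge.map_comp]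
        rw [DirEdge.map_congr (g := fun x => x), DirEdge.map_id']
        intro y _
        exact (fibreEquiv χ k).symm_apply_apply y
      rw [← e] at hH
      exact P.iso_closed _ _ ⟨(fibreEquiv χ k).symm, fun _ => Iff.rfl⟩ (hf k hk _ ((comap_fibreEquiv_mem_starJoin G χ k _).1 hH))

variable {P} in
theorem IsDecomposition.exists_eq_fibres {V : Type} [Finite V] {G : DirHypergraph V C} {n : ℕ}
    {d : Fin n → Set V} (h : P.IsDecomposition G d) :
    ∃ χ : V → Fin n, d = fun i => χ ⁻¹' {i} := by
  have hc : ∀ v, ∃ i, v ∈ d i := fun v => by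
    have : v ∈ ⋃ i, d i := h.cover ▸ Set.mem_univ v
    simpa using this
  choose χ hχ using hc
  refine ⟨χ, funext fun i => Set.ext fun v => ⟨fun hv => ?_, ?_⟩⟩
  · by_contra hne
    exact Set.disjoint_left.1 (h.disjoint _ _ hne) (hχ v) hv
  · rintro rfl
    exact hχ v

theorem bddAbove_card_decompositions {V : Type} [Finite V] (G : DirHypergraph V C) :
    BddAbove {n : ℕ | ∃ d : Fin n → Set V, P.IsDecomposition G d} := by
  refine ⟨Nat.card V, ?_⟩
  rintro n ⟨d, hd⟩
  obtain ⟨χ, rfl⟩ := hd.exists_eq_fibres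
  simpa using Nat.card_le_card_of_surjective χ ((P.isDecomposition_fibres_iff G χ).1 hd).1

variable {P} in
theorem IsDecomposition.le_decOf {V : Type} [Finite V] {G : DirHypergraph V C} {n : ℕ}
    {d : Fin n → Set V} (hG : P.Holds G) (h : P.IsDecomposition G d) : n ≤ P.decOf G := by
  rw [decOf, if_pos hG]
  exact le_csSup (P.bddAbove_card_decompositions G) ⟨d, h⟩

/-- A nonzero value rules out both `G ∉ P` and the supremum of the empty set, so the maximum is
attained. -/
theorem exists_isDecomposition_decOf {V : Type} [Finite V] {G : DirHypergraph V C}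
    (h : P.decOf G ≠ 0) : ∃ d : Fin (P.decOf G) → Set V, P.IsDecomposition G d := by
  have hG : P.Holds G := by
    by_contra hG
    exact h (if_neg hG)
  have e : P.decOf G = sSup {n : ℕ | ∃ d : Fin n → Set V, P.IsDecomposition G d} := if_pos hG
  have hne : {n : ℕ | ∃ d : Fin n → Set V, P.IsDecomposition G d}.Nonempty := by
    rw [Set.nonempty_iff_ne_empty]
    intro h0
    rw [h0] at e
    exact h (by simpa using e)
  rw [e]
  exact Nat.sSup_mem hne (P.bddAbove_card_decompositions G)

variable {P} in
theorem IsFree.card_range_le_decOf {V : Type} [Finite V] {ι : Type*} {G : DirHypergraph V C}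
    {χ : V → ι} (hG : P.Holds G) (h : P.IsFree G χ) :
    Nat.card (Set.range χ) ≤ P.decOf G := by
  let E := Finite.equivFin (Set.range χ)
  let ψ : V → Fin (Nat.card (Set.range χ)) := E ∘ Set.rangeFactorization χ
  have hψ : P.IsFree G ψ := by
    refine IsFree.of_injective (g := Subtype.val ∘ E.symm)
      (Subtype.val_injective.comp E.symm.injective) ?_
    convert h
    ext v
    simp only [ψ, Function.comp_apply, Equiv.symm_apply_apply]
    rfl
  exact ((P.isDecomposition_fibres_iff G ψ).2
    ⟨E.surjective.comp Set.rangeFactorization_surjective, hψ⟩).le_decOf hG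

/-- If `t` has all `dec_P(G)` colours and its classes do not refine those of `u`, then the
common refinement is too large to be a decomposition. -/
theorem not_isFree_prod {V : Type} [Finite V] {G : DirHypergraph V C} (hG : P.Holds G)
    {n : ℕ} (hn : P.decOf G = n) {κ : Type*} {t : V → Fin n} (ht : Function.Surjective t)
    {u : V → κ} (htu : ¬ ∀ v w, t v = t w → u v = u w) :
    ¬ P.IsFree G (fun v => (t v, u v)) := by
  intro h
  have hle := h.card_range_le_decOf hG
  rw [hn] at hle
  let f : Set.range (fun v => (t v, u v)) → Fin n := fun y => y.1.1
  have hf : Function.Surjective f := fun i => by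
    obtain ⟨v, rfl⟩ := ht i
    exact ⟨⟨_, v, rfl⟩, rfl⟩
  -- At most `n` pairs occur and they project onto all `n` values of `t`, so `t` determines `u`.
  have hb := (Function.Surjective.bijective_of_nat_card_le hf (by simpa using hle)).1
  apply htu
  intro v w hvw
  have := @hb ⟨_, v, rfl⟩ ⟨_, w, rfl⟩ hvw
  simpa using (congrArg (fun y => y.1.2) this)

/-! ### Strict hypergraphs. -/

variable {P} in
/-- In a decomposition of a hypergraph, every part meets every strict induced subhypergraph. -/
theorem IsStrict.exists_colour_eq (hher : P.InducedHereditary) {V W : Type} [Finite V]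
    [Finite W] {ι : Type*} {H : DirHypergraph W C} {f : V ↪ W} (hs : P.IsStrict (H.comap f))
    {χ : W → ι} (h : P.AllAgree H χ) (z : W) : ∃ v, χ (f v) = χ z := by
  by_contra! hz
  refine hs.2 fun K hK => ?_
  let g : V ⊕ Unit ↪ W := ⟨Sum.elim f fun _ => z, by
    refine f.injective.sumElim (fun _ _ _ => rfl) fun v _ hv => hz v (by rw [hv])⟩
  -- If the colour of `z` were missing on the copy, every edge joining `z` to the copy would be
  -- unconstrained, so every member of the join with `K₁` would be in `P`.
  refine h.comap hher g K ?_
  rintro e ⟨c, hc⟩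
  by_cases he : ∀ y ∈ e.1, ∃ v, (Function.Embedding.inl : V ↪ V ⊕ Unit) v = y
  · obtain ⟨e, rfl⟩ := DirEdge.exists_map_eq _ _ he
    rw [← mem_comap, ← mem_comap, hK.1, comap_comap]
    rfl
  · push Not at he
    obtain ⟨y, hy, hy'⟩ := he
    have hall : ∀ y ∈ e.1, y = Sum.inr () := by
      have hcz : χ z = c := by
        rcases y with v | ⟨⟩
        · exact (hy' v rfl).elim
        · exact hc _ hy
      rintro (v | ⟨⟩) hv
      · exact (hz v ((hc _ hv).trans hcz.symm)).elim
      · rfl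
    have hno : e.1.Nodup → ¬ 2 ≤ e.1.length := fun hd h2 => by
      have h01 := (hd.getElem_inj_iff (i := 0) (j := 1) (hi := by omega) (hj := by omega)).1
        ((hall _ (List.getElem_mem _)).trans (hall _ (List.getElem_mem _)).symm)
      omega
    exact ⟨fun h => (hno ((H.comap g).nodup _ h) ((H.comap g).no_loops _ h)).elim,
      fun h => (hno (K.nodup _ h) (K.no_loops _ h)).elim⟩

variable {P} in
-- Any member `K` of the join of the subhypergraph with `K₁` is induced in a member of `H * K₁`:
-- overwrite `H ⊔ K₁` by `K` on the smaller vertex set.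
theorem IsStrict.of_comap (hher : P.InducedHereditary) {V W : Type} [Finite V]
    [Finite W] {H : DirHypergraph W C} {f : V ↪ W} (hs : P.IsStrict (H.comap f))
    (hH : P.Holds H) : P.IsStrict H := by
  refine ⟨hH, fun hall => hs.2 fun K hK => ?_⟩
  let g : V ⊕ Unit ↪ W ⊕ Unit := f.sumMap (Function.Embedding.refl _)
  have hag : Agree (Sum.isLeft ∘ g) ((H.disjUnion (kOne C)).comap g) K := by
    have hg : (Sum.isLeft ∘ g : V ⊕ Unit → Bool) = Sum.isLeft := by
      ext (v | v) <;> rfl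
    rintro e ⟨c, hc⟩
    rw [hg] at hc
    rcases exists_map_inl_or_inr hc with ⟨e, rfl⟩ | ⟨e, rfl⟩
    · have h1 : DirEdge.map g (DirEdge.map Sum.inl e) = DirEdge.map Sum.inl (DirEdge.map f e) := by
        simp only [DirEdge.map_comp]
        rfl
      rw [mem_comap, h1, map_inl_mem_disjUnion, ← mem_comap, ← hK.1]
      rfl
    · have h1 : DirEdge.map g (DirEdge.map Sum.inr e) = DirEdge.map Sum.inr e := by
        simp only [DirEdge.map_comp]
        rfl
      rw [mem_comap, h1, map_inr_mem_disjUnion, ← hK.2]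
      rfl
  have hp := agree_patch hag
  have := hher.comap (hall (patch g K (H.disjUnion (kOne C))) ⟨?_, ?_⟩) g
  · rwa [comap_patch] at this
  · ext e
    have := hp (DirEdge.map Sum.inl e) ⟨true, by simp [DirEdge.mem_map]⟩
    rw [map_inl_mem_disjUnion] at this
    exact this.symm
  · ext e
    have := hp (DirEdge.map Sum.inr e) ⟨false, by simp [DirEdge.mem_map]⟩
    rw [map_inr_mem_disjUnion] at this
    exact this.symm

/-! ### Amalgams of copies of `G`. -/

/-- `H` consists of copies of `G` indexed by `I`, and an edge of `H` that lies inside one class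
of `u` lies inside one copy. -/
structure IsAmalgam {V : Type} {κ : Type*} (G : DirHypergraph V C) (u : V → κ) {I : Type}
    (H : DirHypergraph (I × V) C) : Prop where
  comap_eq : ∀ i, H.comap ⟨Prod.mk i, Prod.mk_right_injective i⟩ = G
  same_copy : ∀ e ∈ H.edges, (∃ c, ∀ y ∈ e.1, u y.2 = c) → ∃ i, ∀ y ∈ e.1, y.1 = i

theorem IsAmalgam.mem_iff {V : Type} {κ : Type*} {G : DirHypergraph V C} {u : V → κ} {I : Type}
    {H : DirHypergraph (I × V) C} (h : IsAmalgam G u H) {e : DirEdge (I × V) C}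
    (he : ∃ c, ∀ y ∈ e.1, u y.2 = c) :
    e ∈ H.edges ↔ ∃ i, (∀ y ∈ e.1, y.1 = i) ∧ DirEdge.map Prod.snd e ∈ G.edges := by
  have key : ∀ i, (∀ y ∈ e.1, y.1 = i) → (e ∈ H.edges ↔ DirEdge.map Prod.snd e ∈ G.edges) := by
    intro i hi
    rw [← h.comap_eq i, mem_comap, DirEdge.map_comp, DirEdge.map_congr (g := fun x => x),
      DirEdge.map_id']
    intro y hy
    exact Prod.ext (hi y hy).symm rfl
  constructor
  · intro hH
    obtain ⟨i, hi⟩ := h.same_copy e hH he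
    exact ⟨i, hi, (key i hi).1 hH⟩
  · rintro ⟨i, hi, hG⟩
    exact (key i hi).2 hG

variable {P} in
-- Inside the classes of `u`, an amalgam is indistinguishable from `|I|` disjoint copies of `G`.
theorem IsAmalgam.holds (hher : P.InducedHereditary) {V : Type} [Finite V] {κ : Type*}
    {G : DirHypergraph V C} {u : V → κ} (hu : P.IsFree G u) {I : Type} [Finite I] [Nonempty I]
    {H : DirHypergraph (I × V) C} (h : IsAmalgam G u H) : P.Holds H := by
  let E := Finite.equivFin I
  refine (hu (Nat.card I) Nat.card_pos).comap hher
    (E.prodCongr (Equiv.refl V)).toEmbedding H fun e he => ?_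
  rw [h.mem_iff he, mem_comap, mem_copies, DirEdge.map_comp, ← E.exists_congr_right]
  refine exists_congr fun i => and_congr ?_ Iff.rfl
  simp only [DirEdge.mem_map]
  constructor
  · intro h y hy
    exact E.injective (h _ ⟨y, hy, rfl⟩)
  · rintro h _ ⟨y, hy, rfl⟩
    exact congrArg E (h y hy)

/-! ### The blow-up that excludes one more bad colouring. -/

section Gadget

variable {V : Type} {κ : Type} {k : ℕ} {I : Type}

/-- Send the class `u = l` of the `p`-th copy of `V` to the copy of `V` chosen by `a` in the
block `(p, l)`. -/
def transversal (u : V → κ) (a : Fin k × κ → I) : Fin k × V ↪ ((Fin k × κ) × I) × V where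
  toFun y := (((y.1, u y.2), a (y.1, u y.2)), y.2)
  inj' := by
    rintro ⟨p, v⟩ ⟨q, w⟩ h
    simp_all

/-- The `q`-th block. -/
def block (q : Fin k × κ) : I × V ↪ ((Fin k × κ) × I) × V where
  toFun y := ((q, y.1), y.2)
  inj' := by
    rintro ⟨p, v⟩ ⟨q, w⟩ h
    simp_all

/-- Put `H` on every block, and the edges of `F` that are not inside a class of `u` on every
transversal. -/
def blowUp [Finite I] [Finite κ] (u : V → κ) (F : DirHypergraph (Fin k × V) C)
    (H : DirHypergraph (I × V) C) : DirHypergraph (((Fin k × κ) × I) × V) C where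
  edges := (⋃ q, DirEdge.map (block q) '' H.edges) ∪
    ⋃ a : Fin k × κ → I, DirEdge.map (transversal u a) ''
      {e ∈ F.edges | ¬ ∃ l, ∀ y ∈ e.1, u y.2 = l}
  finite_edges := (Set.finite_iUnion fun _ => H.finite_edges.image _).union
    (Set.finite_iUnion fun _ => (F.finite_edges.subset fun _ h => h.1).image _)
  nodup := by
    intro e' he'
    simp only [Set.mem_union, Set.mem_iUnion, Set.mem_image] at he'
    rcases he' with ⟨q, e, he, rfl⟩ | ⟨a, e, he, rfl⟩
    · exact (H.nodup e he).map (block q).injective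
    · exact (F.nodup e he.1).map (transversal u a).injective
  no_loops := by
    intro e' he'
    simp only [Set.mem_union, Set.mem_iUnion, Set.mem_image] at he'
    rcases he' with ⟨q, e, he, rfl⟩ | ⟨a, e, he, rfl⟩
    · simpa [DirEdge.map] using H.no_loops e he
    · simpa [DirEdge.map] using F.no_loops e he.1

variable [Finite I] [Finite κ] {u : V → κ} {F : DirHypergraph (Fin k × V) C}
  {H : DirHypergraph (I × V) C}

/-- On a transversal the block label equals the value of `u`, so either alternative would force the
underlying edge of `F` into one class of `u`. The disjunction serves edges inside a block and edges
inside a class alike. -/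
theorem exists_block_of_mem_blowUp {e : DirEdge (((Fin k × κ) × I) × V) C}
    (he : e ∈ (blowUp u F H).edges) (hl : ∃ l, ∀ y ∈ e.1, y.1.1.2 = l ∨ u y.2 = l) :
    ∃ q, ∃ e' ∈ H.edges, DirEdge.map (block q) e' = e := by
  simp only [blowUp, Set.mem_union, Set.mem_iUnion] at he
  rcases he with ⟨q, he⟩ | ⟨a, e, he, rfl⟩
  · exact ⟨q, he⟩
  · refine (he.2 ?_).elim
    obtain ⟨l, hl⟩ := hl
    exact ⟨l, fun y hy => (or_self_iff (a := u y.2 = l)).1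
      (hl _ ((DirEdge.mem_map _ _ _).2 ⟨y, hy, rfl⟩))⟩

theorem blowUp_comap_block (q : Fin k × κ) : (blowUp u F H).comap (block q) = H := by
  ext e
  constructor
  · intro he
    obtain ⟨q', e', he', h⟩ := exists_block_of_mem_blowUp he ⟨q.2, fun y hy => by
      obtain ⟨x, -, rfl⟩ := (DirEdge.mem_map _ _ _).1 hy
      exact Or.inl rfl⟩
    have h' := congrArg (DirEdge.map fun y => (y.1.2, y.2)) h
    simp only [DirEdge.map_comp] at h'
    rwa [← (DirEdge.map_id' e' : DirEdge.map _ e' = e').symm.trans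
      (h'.trans (DirEdge.map_id' e))]
  · exact fun he => Or.inl (Set.mem_iUnion.2 ⟨q, e, he, rfl⟩)

theorem IsAmalgam.blowUp {G : DirHypergraph V C} (h : IsAmalgam G u H) :
    IsAmalgam G u (blowUp u F H) where
  comap_eq := by
    rintro ⟨q, i⟩
    rw [← h.comap_eq i, ← blowUp_comap_block (u := u) (F := F) (H := H) q, comap_comap]
    rw [blowUp_comap_block]
    rfl
  same_copy := by
    rintro e he ⟨c, hc⟩
    obtain ⟨q, e, he', rfl⟩ := exists_block_of_mem_blowUp he ⟨c, fun y hy => Or.inr (hc y hy)⟩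
    obtain ⟨i, hi⟩ := h.same_copy e he' ⟨c, fun y hy =>
      hc _ ((DirEdge.mem_map _ _ _).2 ⟨y, hy, rfl⟩)⟩
    refine ⟨(q, i), fun y hy => ?_⟩
    obtain ⟨x, hx, rfl⟩ := (DirEdge.mem_map _ _ _).1 hy
    exact congrArg (Prod.mk q) (hi x hx)

/-- Distinct classes of `u` go to distinct blocks, so no block edge interferes; overlapping
transversals add nothing, since projection recovers the edge of `F`. -/
theorem map_transversal_mem_blowUp_iff (a : Fin k × κ → I) {e : DirEdge (Fin k × V) C}
    (he : ¬ ∃ l, ∀ y ∈ e.1, u y.2 = l) :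
    DirEdge.map (transversal u a) e ∈ (HypergraphProperty.blowUp u F H).edges ↔
      e ∈ F.edges := by
  constructor
  · intro h
    simp only [HypergraphProperty.blowUp, Set.mem_union, Set.mem_iUnion] at h
    rcases h with ⟨q, e', -, h⟩ | ⟨b, e', he', h⟩
    · refine (he ⟨q.2, fun y hy => ?_⟩).elim
      have : transversal u a y ∈ (DirEdge.map (block q) e').1 := by
        rw [h]
        exact (DirEdge.mem_map _ _ _).2 ⟨y, hy, rfl⟩
      obtain ⟨x, -, hx⟩ := (DirEdge.mem_map _ _ _).1 this
      exact (congrArg (fun z => z.1.1.2) hx).symm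
    · have h' := congrArg (DirEdge.map fun y => (y.1.1.1, y.2)) h
      simp only [DirEdge.map_comp] at h'
      have : e' = e := (DirEdge.map_id' e').symm.trans (h'.trans (DirEdge.map_id' e))
      exact this ▸ he'.1
  · exact fun h => Or.inr (Set.mem_iUnion.2 ⟨a, e, ⟨h, he⟩, rfl⟩)

/-- `F` agrees with the hypergraph induced by a transversal of the blow-up. -/
theorem agree_comap_transversal {ι : Type*} {G : DirHypergraph V C} (h : IsAmalgam G u H)
    {t : V → ι} (hF : Agree ((fun v => (t v, u v)) ∘ Prod.snd) (G.copies k) F)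
    (a : Fin k × κ → I) :
    Agree (t ∘ Prod.snd) ((HypergraphProperty.blowUp u F H).comap (transversal u a)) F := by
  rintro e ⟨c, hc⟩
  rw [mem_comap]
  -- Inside a class of `u`, the edge lies in a class of `(t, u)`, where both sides look like `kG`;
  -- otherwise the blow-up copies `F`.
  by_cases he : ∃ l, ∀ y ∈ e.1, u y.2 = l
  · obtain ⟨l, hl⟩ := he
    rw [← hF e ⟨(c, l), fun y hy => Prod.ext (hc y hy) (hl y hy)⟩, mem_copies,
      h.blowUp.mem_iff ⟨l, ?_⟩, DirEdge.map_comp]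
    · constructor
      · rintro ⟨⟨⟨p, l'⟩, i⟩, hi, hG⟩
        refine ⟨p, fun y hy => ?_, hG⟩
        exact congrArg (fun z => z.1.1) (hi _ ((DirEdge.mem_map _ _ _).2 ⟨y, hy, rfl⟩))
      · rintro ⟨p, hp, hG⟩
        refine ⟨((p, l), a (p, l)), fun y hy => ?_, hG⟩
        obtain ⟨x, hx, rfl⟩ := (DirEdge.mem_map _ _ _).1 hy
        change ((x.1, u x.2), a (x.1, u x.2)) = _
        rw [hp x hx, hl x hx]
    · intro y hy
      obtain ⟨x, hx, rfl⟩ := (DirEdge.mem_map _ _ _).1 hy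
      exact hl x hx
  · exact map_transversal_mem_blowUp_iff a he

end Gadget

/-! ### Avoiding all bad colourings, and the conclusion. -/

variable {P} in
/-- Partitions of `G` whose common refinement with `u` is not a decomposition can be avoided on
some copy of `G` in a suitable amalgam. -/
theorem exists_isAmalgam_avoiding (hher : P.InducedHereditary) {V : Type} [Finite V]
    [Nonempty V] {κ ι : Type} [Finite κ] (G : DirHypergraph V C) (u : V → κ)
    (S : Set (V → ι)) (hS : S.Finite) (hSu : ∀ t ∈ S, ¬ P.IsFree G (fun v => (t v, u v))) :
    ∃ (I : Type) (_ : Finite I) (_ : Nonempty I) (H : DirHypergraph (I × V) C),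
      IsAmalgam G u H ∧
        ∀ χ : I × V → ι, P.AllAgree H χ → ∃ i, (fun v => χ (i, v)) ∉ S := by
  induction S, hS using Set.Finite.induction_on with
  | empty =>
    refine ⟨Unit, inferInstance, inferInstance,
      G.comap (Equiv.punitProd V).toEmbedding, ⟨fun i => ?_, fun e _ _ => ?_⟩, fun χ _ => ?_⟩
    · rw [comap_comap]
      ext e
      exact iff_of_eq (congrArg (· ∈ G.edges) (DirEdge.map_id' e))
    · exact ⟨(), fun _ _ => rfl⟩
    · exact ⟨(), fun h => h⟩
  | @insert t S _ _ ih =>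
    obtain ⟨I, _, _, H, hH, hav⟩ := ih fun s hs => hSu s (Set.mem_insert_of_mem t hs)
    obtain ⟨k, hk, F, hF, hFP⟩ : ∃ k, 0 < k ∧ ∃ F,
        Agree ((fun v => (t v, u v)) ∘ Prod.snd) (G.copies k) F ∧ ¬ P.Holds F := by
      have := hSu t (Set.mem_insert t S)
      simp only [IsFree, AllAgree] at this
      push Not at this
      exact this
    have : Nonempty (Fin k) := ⟨⟨0, hk⟩⟩
    have : Nonempty κ := ⟨u (Classical.arbitrary V)⟩
    refine ⟨(Fin k × κ) × I, inferInstance, inferInstance, blowUp u F H, hH.blowUp,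
      fun χ hχ => ?_⟩
    have hq : ∀ q : Fin k × κ, ∃ i, (fun v => χ ((q, i), v)) ∉ S := fun q => by
      have := hχ.comap hher (block q)
      rw [blowUp_comap_block] at this
      exact hav _ this
    -- By induction each block has a copy not coloured from `S`. If all copies were bad, these would
    -- be coloured by `t`, so their transversal would carry exactly `t` and force `F ∈ P`.
    choose a ha using hq
    by_contra! hall
    have hat : ∀ q v, χ ((q, a q), v) = t v := fun q v =>
      congrFun ((hall (q, a q)).resolve_right (ha q)) v
    refine hFP (hχ.comap hher (transversal u a) F ?_)
    have e : χ ∘ transversal u a = t ∘ Prod.snd := funext fun y => hat _ _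
    rw [e]
    exact agree_comap_transversal hH hF a

end HypergraphProperty

open DirHypergraph HypergraphProperty in
theorem mainTheorem9 {C : Type*} (P : HypergraphProperty C)
    (hher : P.InducedHereditary) (hadd : P.Additive)
    {V : Type} [Finite V] (G : DirHypergraph V C)
    (hstrict : P.IsStrict G) (hdec : P.decOf G = P.dec)
    {m : ℕ} (d₀ : Fin m → Set V) (hd₀ : P.IsDecomposition G d₀) :
    ∃ d : Fin P.dec → Set V, P.IsDecomposition G d ∧ PartsRespect d d₀ := by
  have hm := hd₀.le_decOf hstrict.1
  rw [hdec] at hm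
  rcases Nat.eq_zero_or_pos P.dec with h0 | hpos
  · obtain rfl : m = P.dec := by omega
    exact ⟨d₀, hd₀, fun i => ⟨i, subset_rfl⟩⟩
  have hV : Nonempty V := by
    obtain ⟨d, hd⟩ := P.exists_isDecomposition_decOf (G := G) (by omega)
    exact ⟨(hd.nonempty ⟨0, by omega⟩).some⟩
  obtain ⟨u, rfl⟩ := hd₀.exists_eq_fibres
  have hu := ((P.isDecomposition_fibres_iff G u).1 hd₀).2
  let S : Set (V → Fin P.dec) :=
    {t | Function.Surjective t ∧ ¬ ∀ v w, t v = t w → u v = u w}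
  obtain ⟨I, _, _, H, hH, hav⟩ := exists_isAmalgam_avoiding hher G u S (Set.toFinite S)
    fun t ht => P.not_isFree_prod hstrict.1 hdec ht.1 ht.2
  have hHs : P.IsStrict H := by
    obtain ⟨i⟩ := ‹Nonempty I›
    refine IsStrict.of_comap hher (f := ⟨Prod.mk i, Prod.mk_right_injective i⟩) ?_
      (hH.holds hher hu)
    rwa [hH.comap_eq]
  have hle : P.dec ≤ P.decOf H := Nat.sInf_le ⟨_, inferInstance, H, hHs, rfl⟩
  obtain ⟨d, hd⟩ := P.exists_isDecomposition_decOf (G := H) (by omega)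
  obtain ⟨χ, rfl⟩ := hd.exists_eq_fibres
  obtain ⟨hχ, hfree⟩ := (P.isDecomposition_fibres_iff H χ).1 hd
  have hcopy : ∀ i, Function.Surjective (fun v => χ (i, v)) ∧
      P.IsFree G (fun v => χ (i, v)) := by
    intro i
    have h1 := hfree.comap hher ⟨Prod.mk i, Prod.mk_right_injective i⟩
    rw [hH.comap_eq] at h1
    refine ⟨fun c => ?_, h1⟩
    obtain ⟨z, rfl⟩ := hχ c
    refine IsStrict.exists_colour_eq hher (f := ⟨Prod.mk i, Prod.mk_right_injective i⟩) ?_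
      (hfree.allAgree hher) z
    rwa [hH.comap_eq]
  have hN : P.decOf H = P.dec := by
    refine le_antisymm ?_ hle
    obtain ⟨i⟩ := ‹Nonempty I›
    rw [← hdec]
    exact ((P.isDecomposition_fibres_iff G _).2 (hcopy i)).le_decOf hstrict.1
  clear hd hle
  -- The number of colours is a type index, so the equality `hN` is applied with `χ` generalized.
  revert χ
  rw [hN]
  intro χ hχ hfree hcopy
  obtain ⟨i, hi⟩ := hav χ (hfree.allAgree hher)
  refine ⟨_, (P.isDecomposition_fibres_iff G _).2 (hcopy i), fun c => ?_⟩
  obtain ⟨v, rfl⟩ := (hcopy i).1 c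
  refine ⟨u v, fun w hw => ?_⟩
  have hres : ∀ v w, χ (i, v) = χ (i, w) → u v = u w := by
    by_contra h
    exact hi ⟨(hcopy i).1, h⟩
  exact hres w v hw
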